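/- Let $P$ and $Q$ be lattice paths from $(0,0)$ to $(m,r)$, that is, words of $n=m+r$ unit steps, $m$ of them east and $r$ of them north, with $P$ never going above $Q$. Let $u_1<\dots<u_r$ and $l_1<\dots<l_r$ be the positions of the north steps in the words $P$ and $Q$, respectively. The lattice path matroid $M[P,Q]$ is the transversal matroid on $[n]=\{1,\dots,n\}$ with presentation $(N_1,\dots,N_r)$, where $N_i=\{l_i,l_i+1,\dots,u_i\}$. In the diagram of unit squares in the region bounded by $P$ and $Q$, label the rows $1,\dots,r$ from bottom to top and the columns $r+1,\dots,n$ from left to right, and let $A_i$ consist of $i$ and the labels of all columns that have a square in row $i$. The rook matroid $R[P,Q]$ is the transversal matroid on $[n]$ with presentation $(A_1,\dots,A_r)$. (The independent sets of the transversal matroid with presentation $(B_1,\dots,B_r)$ are the sets $I\subseteq[n]$ for which there is an injection $\phi:I\to[r]$ with $x\in B_{\phi(x)}$ for all $x\in I$.) A cyclic flat of a matroid $M$ is a flat that is a (possibly empty) union of circuits; ordered by inclusion, the cyclic flats form a lattice $\mathcal{Z}(M)$. A tuple $(L,s,\rho,k)$, with $L$ a lattice, is the configuration of $M$ if $k=|E(M)|$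 and there is a lattice isomorphism $\phi:L\to\mathcal{Z}(M)$ with $s(x)=|\phi(x)|$ and $\rho(x)=r_M(\phi(x))$ for all $x\in L$. Two matroids have the same configuration if some tuple is the configuration of both. Theorem. The matroids $M[P,Q]$ and $R[P,Q]$ have the same configuration. -/

import Mathlib

/-! ### Cyclic flats and configurations -/

/-- A cyclic set of a matroid is a (possibly empty) union of circuits. -/
def IsCyclicSet {α : Type*} (M : Matroid α) (X : Set α) : Prop :=
  ∃ S : Set (Set α), (∀ C ∈ S, M.IsCircuit C) ∧ X = ⋃₀ S

/-- A cyclic flat is a flat that is cyclic. -/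
def IsCyclicFlat {α : Type*} (M : Matroid α) (X : Set α) : Prop :=
  M.IsFlat X ∧ IsCyclicSet M X

/-- The poset `𝒵(M)` of cyclic flats of `M`; as a subtype of `Set α`, it is ordered by inclusion. -/
abbrev CyclicFlats {α : Type*} (M : Matroid α) : Type _ := {X : Set α // IsCyclicFlat M X}

/-- The tuple `(L, s, ρ, n)`, with `L` a lattice, is the configuration of `M`: the ground set of `M`
has `n` elements, and some isomorphism `φ` of `L` onto the lattice of cyclic flats of `M` satisfies
`s x = |φ x|` and `ρ x = r(φ x)` for all `x`. -/
def IsConfiguration {α L : Type*} [Lattice L] (M : Matroid α) (s ρ : L → ℕ) (n : ℕ) : Prop :=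
  M.E.encard = n ∧
    ∃ φ : L ≃o CyclicFlats M, ∀ x : L,
      (φ x : Set α).encard = s x ∧ M.eRk (φ x : Set α) = ρ x

/-- Two matroids have the same configuration if some tuple `(L, s, ρ, n)` is the configuration
of both. -/
def HaveSameConfiguration.{u} {α β : Type u} (M : Matroid α) (N : Matroid β) : Prop :=
  ∃ (L : Type u) (_ : Lattice L) (s ρ : L → ℕ) (n : ℕ),
    IsConfiguration M s ρ n ∧ IsConfiguration N s ρ n

/-! ### Transversal matroids -/

/-- `I` is a partial transversal of the set system `A` on `E`: some injection `φ : I → ι` satisfies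
`x ∈ A (φ x)` for all `x ∈ I`. -/
def IsPartialTransversal {α ι : Type*} (E : Set α) (A : ι → Set α) (I : Set α) : Prop :=
  I ⊆ E ∧ ∃ φ : I → ι, Function.Injective φ ∧ ∀ x : I, (x : α) ∈ A (φ x)

theorem isPartialTransversal_empty {α ι : Type*} (E : Set α) (A : ι → Set α) :
    IsPartialTransversal E A ∅ :=
  ⟨Set.empty_subset _, fun x => x.2.elim, fun x => x.2.elim, fun x => x.2.elim⟩

theorem IsPartialTransversal.subset {α ι : Type*} {E : Set α} {A : ι → Set α} {I J : Set α}
    (hJ : IsPartialTransversal E A J) (hIJ : I ⊆ J) : IsPartialTransversal E A I := by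
  obtain ⟨hE, φ, hφ, hA⟩ := hJ
  exact ⟨hIJ.trans hE, fun x => φ ⟨x, hIJ x.2⟩,
    fun x y h => Subtype.ext (Subtype.mk.inj (hφ h)), fun x => hA _⟩

theorem IsPartialTransversal.augment {α ι : Type*} [Finite ι] {E : Set α} (hEfin : E.Finite)
    {A : ι → Set α} {I J : Set α}
    (hI : IsPartialTransversal E A I) (hJ : IsPartialTransversal E A J)
    (hlt : I.ncard < J.ncard) :
    ∃ e ∈ J, e ∉ I ∧ IsPartialTransversal E A (insert e I) := by
  classical
  obtain ⟨hIE, φ₀, hφ₀⟩ := hI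
  obtain ⟨hJE, ψ, hψ, hψA⟩ := hJ
  have hIfin : Finite I := (hEfin.subset hIE).to_subtype
  have hJfin : Finite J := (hEfin.subset hJE).to_subtype
  obtain ⟨φ, ⟨hφ, hφA⟩, hmax⟩ := Set.exists_max_image
    {φ : I → ι | Function.Injective φ ∧ ∀ x : I, (x : α) ∈ A (φ x)}
    (fun φ => {x : I | ∃ h : (x : α) ∈ J, φ x = ψ ⟨x, h⟩}.ncard) (Set.toFinite _) ⟨φ₀, hφ₀⟩
  obtain ⟨j, ⟨⟨x, hxJ⟩, rfl⟩, hj⟩ : ∃ j ∈ Set.range ψ, j ∉ Set.range φ := by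
    apply Set.exists_mem_notMem_of_ncard_lt_ncard _ (Set.toFinite _)
    rw [← Set.image_univ, ← Set.image_univ, Set.ncard_image_of_injective _ hφ,
      Set.ncard_image_of_injective _ hψ, Set.ncard_univ, Set.ncard_univ]
    exact hlt
  have hj' : ∀ y, φ y ≠ ψ ⟨x, hxJ⟩ := fun y hy => hj ⟨y, hy⟩
  by_cases hxI : x ∈ I
  · exfalso
    have hgood : Function.Injective (Function.update φ ⟨x, hxI⟩ (ψ ⟨x, hxJ⟩)) ∧
        ∀ y : I, (y : α) ∈ A (Function.update φ ⟨x, hxI⟩ (ψ ⟨x, hxJ⟩) y) := by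
      constructor
      · intro y z hyz
        by_cases hy : y = ⟨x, hxI⟩ <;> by_cases hz : z = ⟨x, hxI⟩
        · rw [hy, hz]
        · subst hy
          rw [Function.update_self, Function.update_of_ne hz] at hyz
          exact (hj' z hyz.symm).elim
        · subst hz
          rw [Function.update_self, Function.update_of_ne hy] at hyz
          exact (hj' y hyz).elim
        · rw [Function.update_of_ne hy, Function.update_of_ne hz] at hyz
          exact hφ hyz
      · intro y
        by_cases hy : y = ⟨x, hxI⟩
        · subst hy
          rw [Function.update_self]
          exact hψA ⟨x, hxJ⟩
        · rw [Function.update_of_ne hy]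
          exact hφA y
    refine absurd (hmax _ hgood) (not_le.2 (Set.ncard_lt_ncard ⟨?_, ?_⟩ (Set.toFinite _)))
    · rintro y ⟨h, hy⟩
      have hne : y ≠ ⟨x, hxI⟩ := by
        rintro rfl
        exact hj' _ hy
      exact ⟨h, by rw [Function.update_of_ne hne]; exact hy⟩
    · intro hsub
      obtain ⟨h, hy⟩ := hsub (show (⟨x, hxI⟩ : I) ∈ _ from ⟨hxJ, by rw [Function.update_self]⟩)
      exact hj' _ hy
  · refine ⟨x, hxJ, hxI, Set.insert_subset (hJE hxJ) hIE,
      fun y => if h : (y : α) ∈ I then φ ⟨y, h⟩ else ψ ⟨x, hxJ⟩, ?_, ?_⟩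
    · rintro ⟨y, hy⟩ ⟨z, hz⟩ hyz
      apply Subtype.ext
      by_cases hyI : y ∈ I <;> by_cases hzI : z ∈ I
      · simp only [hyI, hzI, dif_pos] at hyz
        exact Subtype.mk.inj (hφ hyz)
      · simp only [hyI, hzI, dif_pos, dif_neg, not_false_eq_true] at hyz
        exact (hj' _ hyz).elim
      · simp only [hyI, hzI, dif_pos, dif_neg, not_false_eq_true] at hyz
        exact (hj' _ hyz.symm).elim
      · exact (hy.resolve_right hyI).trans (hz.resolve_right hzI).symm
    · rintro ⟨y, hy⟩
      by_cases hyI : y ∈ I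
      · simp only [hyI, dif_pos]
        exact hφA ⟨y, hyI⟩
      · simp only [hyI, dif_neg, not_false_eq_true]
        have := hy.resolve_right hyI
        subst this
        exact hψA ⟨y, hxJ⟩

/-- The transversal matroid on the finite set `E` with presentation `A`: its independent sets are
the partial transversals of `A`. -/
def transversalMatroid {α ι : Type*} [Finite ι] (E : Finset α) (A : ι → Set α) : Matroid α :=
  (IndepMatroid.ofFinite E.finite_toSet (IsPartialTransversal (E : Set α) A)
    (isPartialTransversal_empty _ A)
    (fun _ _ hJ hIJ => hJ.subset hIJ)
    (fun _ _ hI hJ hlt => hI.augment E.finite_toSet hJ hlt)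
    (fun _ hI => hI.1)).matroid

/-! ### Lattice paths -/

/-- The two kinds of steps of a lattice path. -/
inductive LatticeStep : Type
  | north : LatticeStep
  | east : LatticeStep
  deriving DecidableEq

/-- A lattice path from `(0, 0)` to `(m, r)`, as a word of north and east unit steps. -/
structure LatticePath (m r : ℕ) : Type where
  steps : List LatticeStep
  count_east : steps.count LatticeStep.east = m
  count_north : steps.count LatticeStep.north = r

namespace LatticePath

/-- The height (`y`-coordinate) of the path after its first `k` steps. -/
def height {m r : ℕ} (P : LatticePath m r) (k : ℕ) : ℕ :=
  (P.steps.take k).count LatticeStep.north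

/-- `P` never goes above `Q`: on each antidiagonal `x + y = k`, the point of `P` is at most as high
as the point of `Q`. -/
def NeverAbove {m r : ℕ} (P Q : LatticePath m r) : Prop :=
  ∀ k : ℕ, P.height k ≤ Q.height k

/-- The number of steps before the north step of the path in row `i`. Rows are counted from the
bottom, starting with row `0`, so for `i < r` this is the number of steps before the `(i+1)`-st
north step. -/
noncomputable def stepsBeforeNorth {m r : ℕ} (P : LatticePath m r) (i : ℕ) : ℕ :=
  Nat.nth (fun k => P.steps[k]? = some LatticeStep.north) i

/-- The position, counted from `1`, in the word of the path of its north step in row `i`. -/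
noncomputable def northPos {m r : ℕ} (P : LatticePath m r) (i : ℕ) : ℕ :=
  P.stepsBeforeNorth i + 1

/-- The `x`-coordinate of the north step of the path in row `i`. -/
noncomputable def northX {m r : ℕ} (P : LatticePath m r) (i : ℕ) : ℕ :=
  (P.steps.take (P.stepsBeforeNorth i)).count LatticeStep.east

end LatticePath

/-! ### Lattice path matroids and rook matroids -/

/-- The path presentation: the set for row `i` is the interval from the position of the north step
of `Q` in that row to the position of the north step of `P` in that row. -/
def pathPresentation {m r : ℕ} (P Q : LatticePath m r) (i : Fin r) : Set ℕ :=
  Set.Icc (Q.northPos i) (P.northPos i)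

/-- The lattice path matroid `M[P, Q]`, on the ground set `{1, ..., m + r}`. -/
def latticePathMatroid {m r : ℕ} (P Q : LatticePath m r) : Matroid ℕ :=
  transversalMatroid (Finset.Icc 1 (m + r)) (pathPresentation P Q)

/-- The unit square `[c, c + 1] × [i, i + 1]` lies in the region bounded by `P` (below) and `Q`
(above): it is to the right of the north step of `Q` in row `i`, and to the left of that of `P`. -/
def SquareInDiagram {m r : ℕ} (P Q : LatticePath m r) (c i : ℕ) : Prop :=
  Q.northX i ≤ c ∧ c + 1 ≤ P.northX i

/-- The rows of the diagram, from bottom to top, are labeled `1, ..., r`, and its columns, from left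
to right, are labeled `r + 1, ..., r + m`. The set for row `i` (counted from `0`) consists of the
label `i + 1` of the row and the labels of all columns that have a square of the diagram in
that row. -/
def rookPresentation {m r : ℕ} (P Q : LatticePath m r) (i : Fin r) : Set ℕ :=
  {(i : ℕ) + 1} ∪ {e | ∃ c : ℕ, c < m ∧ SquareInDiagram P Q c i ∧ e = r + (c + 1)}

/-- The rook matroid `R[P, Q]`, on the ground set `{1, ..., m + r}`. -/
def rookMatroid {m r : ℕ} (P Q : LatticePath m r) : Matroid ℕ :=
  transversalMatroid (Finset.Icc 1 (m + r)) (rookPresentation P Q)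

/-! ### Dominant index sets and cyclic flats of transversal matroids -/

section Transversal

variable {α ι : Type*}

/-! For a transversal matroid with presentation `A`, let S(K) be the set of elements lying only in
sets indexed by K, and call |S(K)| - |K| the excess of K. By Hall's theorem, K ↦ S(K) is an order
isomorphism from the dominant index sets onto the cyclic flats (`dominantOrderIso`), and S(K) then
has rank |K| (`IsDominant.eRk_supportedOn`). So the configuration depends only on which K are
dominant and on |S(K)| for those K.

For both presentations n - |S(K)| is the size of a union over the rows outside K. In the rook case
it counts these rows and the columns they meet; in the path case the same column intervals are
sheared, row i being shifted by i and lengthened by one. Shearing makes the union larger by at least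
the number of rows, with equality when the set of rows has no gap between overlapping rows
(`card_add_card_intervalCover_le`). So the path excess is at most the rook excess.

The rook excess is n - r - |C|, with C the set of columns met by rows outside K. Enlarging the
complement of K by every row contained in C leaves C alone and closes all gaps, so each K contains a
J with the same rook excess at which both excesses agree. This forces the dominant sets and their
values of |S(K)| to coincide (`haveSameConfiguration_of_card_supportedOn`). -/

@[simp]
theorem transversalMatroid_ground [Finite ι] (E : Finset α) (A : ι → Set α) :
    (transversalMatroid E A).E = E := rfl

@[simp]
theorem transversalMatroid_indep_iff [Finite ι] {E : Finset α} {A : ι → Set α} {I : Set α} :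
    (transversalMatroid E A).Indep I ↔ IsPartialTransversal (E : Set α) A I := by
  simp [transversalMatroid]

open Classical in
/-- The elements of `E` that lie in no set of the presentation `A` indexed outside `K`. -/
noncomputable def supportedOn (E : Finset α) (A : ι → Set α) (K : Finset ι) : Finset α :=
  {e ∈ E | ∀ i, e ∈ A i → i ∈ K}

theorem mem_supportedOn {E : Finset α} {A : ι → Set α} {K : Finset ι} {e : α} :
    e ∈ supportedOn E A K ↔ e ∈ E ∧ ∀ i, e ∈ A i → i ∈ K := by
  simp [supportedOn]

theorem supportedOn_mono {E : Finset α} {A : ι → Set α} {K J : Finset ι} (h : K ⊆ J) :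
    supportedOn E A K ⊆ supportedOn E A J := fun e he => by
  rw [mem_supportedOn] at he ⊢
  exact ⟨he.1, fun i hi => h (he.2 i hi)⟩

theorem supportedOn_subset (E : Finset α) (A : ι → Set α) (K : Finset ι) :
    supportedOn E A K ⊆ E := fun _ he => (mem_supportedOn.1 he).1

/-- `K` is dominant if the excess `|supportedOn E A K| - |K|` is larger than that of every proper
subset of `K`. -/
def IsDominant (E : Finset α) (A : ι → Set α) (K : Finset ι) : Prop :=
  ∀ J ⊂ K, (supportedOn E A J).card + K.card < (supportedOn E A K).card + J.card

theorem isDominant_empty (E : Finset α) (A : ι → Set α) : IsDominant E A ∅ :=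
  fun _ hJ => (Finset.not_ssubset_empty _ hJ).elim

/-- The excess is supermodular. -/
theorem card_supportedOn_add_le [DecidableEq ι] (E : Finset α) (A : ι → Set α) (K J : Finset ι) :
    (supportedOn E A K).card + (supportedOn E A J).card ≤
      (supportedOn E A (K ∪ J)).card + (supportedOn E A (K ∩ J)).card := by
  classical
  rw [← Finset.card_union_add_card_inter]
  refine add_le_add (Finset.card_le_card (Finset.union_subset
    (supportedOn_mono Finset.subset_union_left) (supportedOn_mono Finset.subset_union_right)))
    (Finset.card_le_card fun e he => ?_)
  simp only [Finset.mem_inter, mem_supportedOn] at he ⊢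
  exact ⟨he.1.1, fun i hi => ⟨he.1.2 i hi, he.2.2 i hi⟩⟩

/-- By supermodularity, passing from H to H ∪ K gains at least as much excess as passing from H ∩ K
to K, and that gain is positive by dominance. -/
theorem IsDominant.lt_union [DecidableEq ι] {E : Finset α} {A : ι → Set α} {K H : Finset ι}
    (hK : IsDominant E A K) (h : ¬ K ⊆ H) :
    (supportedOn E A H).card + (H ∪ K).card < (supportedOn E A (H ∪ K)).card + H.card := by
  have h1 := card_supportedOn_add_le E A H K
  have h2 := hK (H ∩ K) ⟨Finset.inter_subset_right,
    fun h' => h (h'.trans Finset.inter_subset_left)⟩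
  have h3 := Finset.card_union_add_card_inter H K
  omega

theorem IsDominant.union [DecidableEq ι] {E : Finset α} {A : ι → Set α} {K J : Finset ι}
    (hK : IsDominant E A K) (hJ : IsDominant E A J) : IsDominant E A (K ∪ J) := by
  intro H hH
  -- Grow H to K ∪ J by adjoining first K, then J; each step that changes the set raises the excess.
  have key : ∀ H' : Finset ι, K ⊆ H' → H' ⊆ K ∪ J →
      (supportedOn E A H').card + (K ∪ J).card ≤ (supportedOn E A (K ∪ J)).card + H'.card ∧
      (H' ≠ K ∪ J →
      (supportedOn E A H').card + (K ∪ J).card < (supportedOn E A (K ∪ J)).card + H'.card) := by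
    intro H' h1 h2
    by_cases hJH : J ⊆ H'
    · obtain rfl := h2.antisymm (Finset.union_subset h1 hJH)
      simp
    · have h3 := hJ.lt_union hJH
      rw [show H' ∪ J = K ∪ J from (Finset.union_subset h2 Finset.subset_union_right).antisymm
        (Finset.union_subset_union_left h1)] at h3
      exact ⟨h3.le, fun _ => h3⟩
  by_cases hKH : K ⊆ H
  · exact (key H hKH hH.1).2 hH.ne
  · have h1 := hK.lt_union hKH
    have h2 := (key (H ∪ K) Finset.subset_union_right
      (Finset.union_subset hH.1 Finset.subset_union_left)).1
    omega

theorem IsDominant.biUnion [DecidableEq ι] {E : Finset α} {A : ι → Set α} (S : Finset (Finset ι))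
    (hS : ∀ K ∈ S, IsDominant E A K) : IsDominant E A (S.biUnion id) := by
  induction S using Finset.induction_on with
  | empty => exact isDominant_empty E A
  | insert K S _ ih =>
    rw [Finset.biUnion_insert]
    exact (hS K (Finset.mem_insert_self _ _)).union
      (ih fun J hJ => hS J (Finset.mem_insert_of_mem hJ))

/-- Otherwise deleting i from K would lose no supported element and so raise the excess. -/
theorem IsDominant.exists_mem {E : Finset α} {A : ι → Set α} {K : Finset ι}
    (hK : IsDominant E A K) {i : ι} (hi : i ∈ K) : ∃ e ∈ supportedOn E A K, e ∈ A i := by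
  classical
  by_contra! h
  have h1 := hK (K.erase i) (Finset.erase_ssubset hi)
  have h2 : supportedOn E A K ⊆ supportedOn E A (K.erase i) := fun e he => by
    have he' := mem_supportedOn.1 he
    exact mem_supportedOn.2 ⟨he'.1, fun j hj => Finset.mem_erase.2
      ⟨fun hji => h e he (hji ▸ hj), he'.2 j hj⟩⟩
  have h3 := Finset.card_le_card h2
  have h4 := Finset.card_erase_lt_of_mem hi
  omega

theorem IsDominant.supportedOn_subset_iff {E : Finset α} {A : ι → Set α} {K J : Finset ι}
    (hK : IsDominant E A K) : supportedOn E A K ⊆ supportedOn E A J ↔ K ⊆ J := by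
  refine ⟨fun h i hi => ?_, supportedOn_mono⟩
  obtain ⟨e, he, hei⟩ := hK.exists_mem hi
  exact (mem_supportedOn.1 (h he)).2 i hei

/-! ### Dominant index sets give cyclic flats -/

theorem IsPartialTransversal.card_le {E : Set α} {A : ι → Set α} {I : Finset α} {K : Finset ι}
    (hI : IsPartialTransversal E A I) (h : ∀ x ∈ I, ∀ i, x ∈ A i → i ∈ K) : I.card ≤ K.card := by
  obtain ⟨-, φ, hφ, hA⟩ := hI
  rw [← Finset.card_attach]
  exact Finset.card_le_card_of_injOn (fun x => φ ⟨x, x.2⟩)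
    (fun x _ => h x x.2 _ (hA ⟨x, x.2⟩))
    (fun x _ y _ hxy => Subtype.ext (Subtype.mk.inj (hφ hxy)))

/-- A dominant set of indices can be matched into its supported elements, avoiding any one of
them; the matched elements form an independent set. -/
theorem IsDominant.exists_indep {E : Finset α} {A : ι → Set α} {K : Finset ι}
    (hK : IsDominant E A K) (e : α) : ∃ B : Finset α, B ⊆ supportedOn E A K ∧ e ∉ B ∧
      B.card = K.card ∧ ∃ φ : B → ι, Function.Injective φ ∧ ∀ x : B, (x : α) ∈ A (φ x) ∧ φ x ∈ K := by
  classical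
  let t : K → Finset α := fun i => {x ∈ supportedOn E A K | x ∈ A i}.erase e
  have hall : ∀ s : Finset K, s.card ≤ (s.biUnion t).card := by
    intro s
    rcases s.eq_empty_or_nonempty with rfl | ⟨i, hi⟩
    · simp
    have hsK : s.map (Function.Embedding.subtype _) ⊆ K := by
      intro j hj
      obtain ⟨k, -, rfl⟩ := Finset.mem_map.1 hj
      exact k.2
    -- Dominance against K \ s says that more than |s| supported elements meet s; the strict
    -- inequality pays for discarding e in Hall's condition.
    have h1 := hK (K \ s.map (Function.Embedding.subtype _))
      ⟨Finset.sdiff_subset, fun h => (Finset.mem_sdiff.1 (h i.2)).2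
        (Finset.mem_map_of_mem (Function.Embedding.subtype _) hi)⟩
    have h2 := Finset.card_sdiff_add_card_eq_card hsK
    rw [Finset.card_map] at h2
    have h3 : supportedOn E A K ⊆ supportedOn E A (K \ s.map (Function.Embedding.subtype _)) ∪
        insert e (s.biUnion t) := by
      intro x hx
      by_cases hxe : x = e
      · simp [hxe]
      by_cases hx' : ∃ j ∈ s, x ∈ A j
      · obtain ⟨j, hj, hxj⟩ := hx'
        refine Finset.mem_union_right _ (Finset.mem_insert_of_mem (Finset.mem_biUnion.2 ⟨j, hj, ?_⟩))
        simp [t, hxe, hx, hxj]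
      · push Not at hx'
        refine Finset.mem_union_left _ (mem_supportedOn.2 ⟨(mem_supportedOn.1 hx).1, fun j hj => ?_⟩)
        refine Finset.mem_sdiff.2 ⟨(mem_supportedOn.1 hx).2 j hj, fun hj' => ?_⟩
        obtain ⟨k, hk, rfl⟩ := Finset.mem_map.1 hj'
        exact hx' k hk hj
    have h4 := (Finset.card_le_card h3).trans (Finset.card_union_le _ _)
    have h5 := Finset.card_insert_le e (s.biUnion t)
    omega
  obtain ⟨f, hf, hft⟩ := (Finset.all_card_le_biUnion_card_iff_exists_injective t).1 hall
  have hft' : ∀ i, f i ≠ e ∧ f i ∈ supportedOn E A K ∧ f i ∈ A i := fun i => by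
    simpa [t] using hft i
  refine ⟨Finset.univ.image f, ?_, ?_, ?_, ?_⟩
  · intro x hx
    obtain ⟨i, -, rfl⟩ := Finset.mem_image.1 hx
    exact (hft' i).2.1
  · intro hx
    obtain ⟨i, -, hi⟩ := Finset.mem_image.1 hx
    exact (hft' i).1 hi
  · simp [Finset.card_image_of_injective _ hf]
  · have hg : ∀ x : (Finset.univ.image f : Finset α), ∃ i, f i = x := fun x => by
      obtain ⟨i, -, hi⟩ := Finset.mem_image.1 x.2
      exact ⟨i, hi⟩
    choose g hg using hg
    refine ⟨fun x => g x, fun x y hxy => Subtype.ext ?_, fun x => ⟨?_, (g x).2⟩⟩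
    · rw [← hg x, ← hg y, Subtype.ext hxy]
    · rw [← hg x]
      simpa [hg x] using (hft' (g x)).2.2

/-- The matched set spans because supported elements can only use the |K| indices of K. An element
that is not supported has an index outside K, free to extend the matching. The second fact gives
flatness; the freedom to avoid e gives cyclicity. -/
theorem IsDominant.exists_isBasis [Finite ι] {E : Finset α} {A : ι → Set α} {K : Finset ι}
    (hK : IsDominant E A K) (e : α) : ∃ B : Finset α, e ∉ B ∧ B.card = K.card ∧
      (transversalMatroid E A).IsBasis (B : Set α) (supportedOn E A K) ∧
      ∀ x ∈ E, x ∉ supportedOn E A K →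
        (transversalMatroid E A).Indep (insert x (B : Set α)) := by
  classical
  obtain ⟨B, hBK, heB, hcard, φ, hφ, hφA⟩ := hK.exists_indep e
  have hBE : B ⊆ E := hBK.trans (supportedOn_subset E A K)
  have hB : (transversalMatroid E A).Indep (B : Set α) :=
    transversalMatroid_indep_iff.2 ⟨hBE, φ, hφ, fun x => (hφA x).1⟩
  refine ⟨B, heB, hcard, ?_, ?_⟩
  · refine hB.isBasis_of_subset_of_subset_closure hBK fun x hx => ?_
    by_cases hxB : x ∈ (B : Set α)
    · exact Matroid.mem_closure_of_mem _ hxB hB.subset_ground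
    rw [hB.mem_closure_iff_of_notMem hxB,
      ← Matroid.not_indep_iff (Set.insert_subset (supportedOn_subset E A K hx) hBE)]
    intro h
    rw [← Finset.coe_insert, transversalMatroid_indep_iff] at h
    have := h.card_le (K := K) fun y hy => by
      rcases Finset.mem_insert.1 hy with rfl | hy
      · exact (mem_supportedOn.1 hx).2
      · exact (mem_supportedOn.1 (hBK hy)).2
    rw [Finset.card_insert_of_notMem hxB] at this
    omega
  · intro x hxE hx
    have : ∃ i, x ∈ A i ∧ i ∉ K := by
      by_contra! h
      exact hx (mem_supportedOn.2 ⟨hxE, h⟩)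
    obtain ⟨i, hxi, hiK⟩ := this
    rw [transversalMatroid_indep_iff]
    refine ⟨Set.insert_subset hxE hBE,
      fun y => if h : (y : α) ∈ B then φ ⟨y, h⟩ else i, ?_, ?_⟩
    · rintro ⟨y, hy⟩ ⟨z, hz⟩ hyz
      apply Subtype.ext
      by_cases hyB : y ∈ B <;> by_cases hzB : z ∈ B
      · simp only [hyB, hzB, dif_pos] at hyz
        exact Subtype.mk.inj (hφ hyz)
      · simp only [hyB, hzB, dif_pos, dif_neg, not_false_eq_true] at hyz
        exact (hiK (hyz ▸ (hφA _).2)).elim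
      · simp only [hyB, hzB, dif_pos, dif_neg, not_false_eq_true] at hyz
        exact (hiK (hyz ▸ (hφA _).2)).elim
      · exact (hy.resolve_right hyB).trans (hz.resolve_right hzB).symm
    · rintro ⟨y, hy⟩
      by_cases hyB : y ∈ B
      · simp only [hyB, dif_pos]
        exact (hφA ⟨y, hyB⟩).1
      · simp only [hyB, dif_neg, not_false_eq_true]
        rw [hy.resolve_right hyB]
        exact hxi

theorem IsDominant.eRk_supportedOn [Finite ι] {E : Finset α} {A : ι → Set α} {K : Finset ι}
    (hK : IsDominant E A K) : (transversalMatroid E A).eRk (supportedOn E A K) = K.card := by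
  rcases (supportedOn E A K).eq_empty_or_nonempty with h | ⟨e, -⟩
  · have hK0 : K = ∅ := by
      refine Finset.eq_empty_iff_forall_notMem.2 fun i hi => ?_
      obtain ⟨e, he, -⟩ := hK.exists_mem hi
      simp [h] at he
    subst hK0
    simp [h]
  · obtain ⟨B, -, hcard, hB, -⟩ := hK.exists_isBasis e
    rw [← hB.encard_eq_eRk, Set.encard_coe_eq_coe_finsetCard, hcard]

theorem IsDominant.isCyclicFlat [Finite ι] {E : Finset α} {A : ι → Set α} {K : Finset ι}
    (hK : IsDominant E A K) :
    IsCyclicFlat (transversalMatroid E A) (supportedOn E A K : Set α) := by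
  refine ⟨?_, {C | (transversalMatroid E A).IsCircuit C ∧ C ⊆ supportedOn E A K},
    fun C hC => hC.1, ?_⟩
  · have hE : (supportedOn E A K : Set α) ⊆ (transversalMatroid E A).E := supportedOn_subset E A K
    rw [Matroid.isFlat_iff_closure_eq]
    refine (Matroid.subset_closure _ _ hE).antisymm' fun x hx => ?_
    by_contra hxK
    obtain ⟨B, hxB, -, hB, hins⟩ := hK.exists_isBasis x
    have hxE := Matroid.mem_ground_of_mem_closure hx
    rw [← hB.closure_eq_closure, hB.indep.mem_closure_iff_of_notMem (by simpa using hxB)] at hx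
    exact hx.not_indep (hins x hxE hxK)
  · refine Set.Subset.antisymm (fun x hx => ?_) (Set.sUnion_subset fun C hC => hC.2)
    obtain ⟨B, hxB, -, hB, -⟩ := hK.exists_isBasis x
    have hxB' : x ∉ (B : Set α) := by simpa using hxB
    have hxcl := hB.subset_closure hx
    refine ⟨(transversalMatroid E A).fundCircuit x B,
      ⟨hB.indep.fundCircuit_isCircuit hxcl hxB', ?_⟩, Matroid.mem_fundCircuit _ _ _⟩
    exact (Matroid.fundCircuit_subset_insert _ _ _).trans (Set.insert_subset hx hB.subset)

/-! ### Every cyclic flat comes from a dominant index set -/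

theorem IsCyclicSet.exists_isBasis_notMem {M : Matroid α} {X : Set α} (hX : IsCyclicSet M X)
    (hXE : X ⊆ M.E) {x : α} (hx : x ∈ X) : ∃ B, M.IsBasis B X ∧ x ∉ B := by
  obtain ⟨S, hS, rfl⟩ := hX
  obtain ⟨C, hCS, hxC⟩ := hx
  obtain ⟨B, hB, hCB⟩ := ((hS C hCS).sdiff_singleton_indep hxC).subset_isBasis_of_subset
    (Set.sdiff_subset.trans (Set.subset_sUnion_of_mem hCS))
  refine ⟨B, hB, fun hxB => (hS C hCS).not_indep (hB.indep.subset fun y hy => ?_)⟩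
  by_cases h : y = x
  · exact h ▸ hxB
  · exact hCB ⟨hy, h⟩

open Classical in
/-- The indices of the sets of the presentation that meet `Y`. -/
noncomputable def indicesMeeting [Fintype ι] (A : ι → Set α) (Y : Finset α) : Finset ι :=
  {i | ∃ y ∈ Y, y ∈ A i}

theorem mem_indicesMeeting [Fintype ι] {A : ι → Set α} {Y : Finset α} {i : ι} :
    i ∈ indicesMeeting A Y ↔ ∃ y ∈ Y, y ∈ A i := by
  simp [indicesMeeting]

/-- The deficiency version of Hall's theorem. -/
theorem exists_indep_card_le [Fintype ι] {E : Finset α} (A : ι → Set α) {X : Finset α}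
    (hX : X ⊆ E) : ∃ Y ⊆ X, ∃ I : Finset α, I ⊆ X ∧ IsPartialTransversal (E : Set α) A I ∧
      X.card + (indicesMeeting A Y).card ≤ I.card + Y.card := by
  classical
  obtain ⟨Y, hYX, hY⟩ := X.powerset.exists_max_image
    (fun Y => (Y.card : ℤ) - (indicesMeeting A Y).card) ⟨∅, by simp⟩
  have hYX := Finset.mem_powerset.1 hYX
  have h0 := hY ∅ (by simp)
  have hemp : indicesMeeting A ∅ = ∅ := by ext; simp [mem_indicesMeeting]
  simp only [hemp, Finset.card_empty, Nat.cast_zero, sub_zero] at h0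
  -- The maximal deficiency; by `h0` the subtraction does not truncate. Adding d dummy indices
  -- available to every element makes Hall's condition hold, and at most d elements are matched to
  -- dummies.
  let d := Y.card - (indicesMeeting A Y).card
  let t : X → Finset (ι ⊕ Fin d) := fun x => (indicesMeeting A {(x : α)}).disjSum Finset.univ
  have hall : ∀ s : Finset X, s.card ≤ (s.biUnion t).card := by
    intro s
    rcases s.eq_empty_or_nonempty with rfl | ⟨i, hi⟩
    · simp
    have h1 := hY (s.map (Function.Embedding.subtype _)) (Finset.mem_powerset.2 fun x hx => by
      obtain ⟨k, -, rfl⟩ := Finset.mem_map.1 hx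
      exact k.2)
    rw [Finset.card_map] at h1
    have h2 : (indicesMeeting A (s.map (Function.Embedding.subtype _))).disjSum
        (Finset.univ : Finset (Fin d)) ⊆ s.biUnion t := by
      intro j hj
      rcases j with j | j
      · rw [Finset.inl_mem_disjSum, mem_indicesMeeting] at hj
        obtain ⟨y, hy, hyj⟩ := hj
        obtain ⟨k, hk, rfl⟩ := Finset.mem_map.1 hy
        exact Finset.mem_biUnion.2 ⟨k, hk, by simpa [t, mem_indicesMeeting] using hyj⟩
      · exact Finset.mem_biUnion.2 ⟨i, hi, by simp [t]⟩
    have h3 := Finset.card_le_card h2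
    rw [Finset.card_disjSum, Finset.card_univ, Fintype.card_fin] at h3
    omega
  obtain ⟨f, hf, hft⟩ := (Finset.all_card_le_biUnion_card_iff_exists_injective t).1 hall
  let I : Finset X := {x | (f x).isLeft}
  refine ⟨Y, hYX, I.map (Function.Embedding.subtype _), ?_, ⟨?_, ?_⟩, ?_⟩
  · intro x hx
    obtain ⟨k, -, rfl⟩ := Finset.mem_map.1 hx
    exact k.2
  · intro x hx
    obtain ⟨k, -, rfl⟩ := Finset.mem_map.1 (Finset.mem_coe.1 hx)
    exact hX k.2
  · have hex : ∀ x : ((I.map (Function.Embedding.subtype _) : Finset α) : Set α),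
        ∃ i, ∃ h : (x : α) ∈ X, f ⟨x, h⟩ = Sum.inl i := by
      rintro ⟨x, hx⟩
      obtain ⟨k, hk, rfl⟩ := Finset.mem_map.1 (Finset.mem_coe.1 hx)
      obtain ⟨i, hi⟩ := Sum.isLeft_iff.1 (Finset.mem_filter.1 hk).2
      exact ⟨i, k.2, hi⟩
    choose g hgX hg using hex
    refine ⟨g, fun x y hxy => Subtype.ext ?_, fun x => ?_⟩
    · have := hf ((hg x).trans ((congrArg Sum.inl hxy).trans (hg y).symm))
      exact Subtype.mk.inj this
    · have := hft ⟨x, hgX x⟩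
      rw [hg x] at this
      simpa [t, mem_indicesMeeting] using this
  · have h1 : ({x | ¬ (f x).isLeft} : Finset X).card ≤ d := by
      have := Finset.card_le_card_of_injOn (s := ({x | ¬ (f x).isLeft} : Finset X))
        (t := (Finset.univ : Finset (Fin d)).map Function.Embedding.inr)
        f (fun x hx => by
          have hx' := (Finset.mem_filter.1 hx).2
          rw [Sum.not_isLeft, Sum.isRight_iff] at hx'
          obtain ⟨j, hj⟩ := hx'
          rw [hj]
          simp) hf.injOn
      simpa using this
    have h2 := Finset.card_filter_add_card_filter_not (s := (Finset.univ : Finset X))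
      (fun x => (f x).isLeft)
    rw [Finset.card_univ, Fintype.card_coe] at h2
    rw [Finset.card_map]
    change I.card + _ = _ at h2
    omega

theorem IsCyclicFlat.exists_isDominant [Finite ι] {E : Finset α} {A : ι → Set α} {X : Set α}
    (hX : IsCyclicFlat (transversalMatroid E A) X) :
    ∃ K, IsDominant E A K ∧ (supportedOn E A K : Set α) = X := by
  classical
  have := Fintype.ofFinite ι
  have hXE : X ⊆ E := hX.1.subset_ground
  obtain ⟨X, rfl⟩ := (E.finite_toSet.subset hXE).exists_finset_coe
  have hXE : X ⊆ E := by simpa using hXE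
  obtain ⟨Y, hYX, I, hIX, hI, hcard⟩ := exists_indep_card_le A hXE
  -- every basis is at least as large as `I`
  have hbasis : ∀ x ∈ X, ∃ B : Finset α, B ⊆ X ∧ x ∉ B ∧ I.card ≤ B.card ∧
      IsPartialTransversal (E : Set α) A B := by
    intro x hx
    obtain ⟨B, hB, hxB⟩ := hX.2.exists_isBasis_notMem hX.1.subset_ground (Finset.mem_coe.2 hx)
    obtain ⟨B, rfl⟩ := (X.finite_toSet.subset hB.subset).exists_finset_coe
    refine ⟨B, by simpa using hB.subset, by simpa using hxB, ?_,
      transversalMatroid_indep_iff.1 hB.indep⟩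
    have h1 := (transversalMatroid_indep_iff.2 hI).encard_le_eRk_of_subset
      (Finset.coe_subset.2 hIX)
    rw [← hB.encard_eq_eRk] at h1
    simpa [Set.encard_coe_eq_coe_finsetCard] using h1
  -- the part of a partial transversal inside `Y` is matched to the indices that `Y` meets
  have hsplit : ∀ (B Z : Finset α) (J : Finset ι), B ⊆ X → IsPartialTransversal (E : Set α) A B →
      (∀ z ∈ Z, ∀ i, z ∈ A i → i ∈ J) → ∀ x ∈ X, x ∉ Z → x ∉ B →
      B.card + 1 ≤ J.card + (X \ Z).card := by
    intro B Z J hBX hB hZ x hx hxZ hxB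
    have h1 : (B ∩ Z).card ≤ J.card :=
      (hB.subset (by simp : ((B ∩ Z : Finset α) : Set α) ⊆ B)).card_le
        fun z hz => hZ z (Finset.mem_inter.1 hz).2
    have h2 : (B \ Z).card + 1 ≤ (X \ Z).card := by
      rw [← Finset.card_insert_of_notMem (a := x) (by simp [hxB])]
      refine Finset.card_le_card (Finset.insert_subset (by simp [hx, hxZ]) ?_)
      exact Finset.sdiff_subset_sdiff hBX le_rfl
    have h3 := Finset.card_inter_add_card_sdiff B Z
    omega
  -- A basis avoiding some x in X \ Y would be smaller than I.
  have hYeq : Y = X := by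
    by_contra hne
    obtain ⟨x, hx, hxY⟩ := Finset.exists_of_ssubset (hYX.ssubset_of_ne hne)
    obtain ⟨B, hBX, hxB, hIB, hB⟩ := hbasis x hx
    have h1 := hsplit B Y (indicesMeeting A Y) hBX hB
      (fun z hz i hi => mem_indicesMeeting.2 ⟨z, hz, hi⟩) x hx hxY hxB
    have h2 := Finset.card_sdiff_add_card_eq_card hYX
    omega
  subst hYeq
  set K := indicesMeeting A Y with hKdef
  have hYK : Y ⊆ supportedOn E A K := fun y hy =>
    mem_supportedOn.2 ⟨hXE hy, fun i hi => mem_indicesMeeting.2 ⟨y, hy, hi⟩⟩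
  have hKI : K.card ≤ I.card := by omega
  -- As |K| ≤ |I|, the set I already uses up K, so it spans everything supported on K; flatness
  -- keeps that inside Y.
  have hKY : supportedOn E A K = Y := by
    refine (hYK.antisymm fun e he => ?_).symm
    by_contra heY
    have heI : e ∉ (I : Set α) := fun h => heY (hIX h)
    have hIind := transversalMatroid_indep_iff.2 hI
    have : e ∈ (transversalMatroid E A).closure I := by
      rw [hIind.mem_closure_iff_of_notMem heI, ← Matroid.not_indep_iff
        (Set.insert_subset (supportedOn_subset E A K he) hIind.subset_ground)]
      intro h
      rw [← Finset.coe_insert, transversalMatroid_indep_iff] at h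
      have := h.card_le (K := K) fun y hy => by
        rcases Finset.mem_insert.1 hy with rfl | hy
        · exact (mem_supportedOn.1 he).2
        · exact (mem_supportedOn.1 (hYK (hIX hy))).2
      rw [Finset.card_insert_of_notMem heI] at this
      omega
    have h2 := Matroid.closure_subset_closure (transversalMatroid E A)
      (Finset.coe_subset.2 hIX) this
    rw [hX.1.closure] at h2
    exact heY h2
  refine ⟨K, fun J hJ => ?_, by rw [hKY]⟩
  rw [hKY]
  -- An x in Y using an index outside J is not supported on J; a basis avoiding x yields the strict
  -- inequality.
  obtain ⟨i, hiK, hiJ⟩ := Finset.exists_of_ssubset hJ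
  obtain ⟨x, hx, hxi⟩ := mem_indicesMeeting.1 hiK
  obtain ⟨B, hBX, hxB, hIB, hB⟩ := hbasis x hx
  have h1 := hsplit B (supportedOn E A J) J hBX hB
    (fun z hz => (mem_supportedOn.1 hz).2) x hx
    (fun h => hiJ ((mem_supportedOn.1 h).2 i hxi)) hxB
  have h2 := Finset.card_sdiff_add_card_eq_card
    ((supportedOn_mono hJ.1 : supportedOn E A J ⊆ _).trans hKY.subset)
  omega

/-! ### Configurations in terms of dominant index sets -/

/-- Dominant index sets correspond to cyclic flats. -/
noncomputable def dominantOrderIso [Finite ι] (E : Finset α) (A : ι → Set α) :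
    {K : Finset ι // IsDominant E A K} ≃o CyclicFlats (transversalMatroid E A) :=
  RelIso.ofSurjective (r := (· ≤ ·)) (s := (· ≤ ·))
    (OrderEmbedding.ofMapLEIff
      (fun K => (⟨supportedOn E A K.1, K.2.isCyclicFlat⟩ : CyclicFlats (transversalMatroid E A)))
      (fun K _ => Finset.coe_subset.trans K.2.supportedOn_subset_iff))
    (fun X => by
      obtain ⟨K, hK, h⟩ := X.2.exists_isDominant
      exact ⟨⟨K, hK⟩, Subtype.ext h⟩)

theorem coe_dominantOrderIso [Finite ι] (E : Finset α) (A : ι → Set α)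
    (K : {K : Finset ι // IsDominant E A K}) :
    (dominantOrderIso E A K : Set α) = supportedOn E A K.1 := rfl

open Classical in
/-- The largest dominant subset of `H`. -/
noncomputable def dominantKernel (E : Finset α) (A : ι → Set α) (H : Finset ι) : Finset ι :=
  (H.powerset.filter (IsDominant E A)).biUnion id

open Classical in
/-- The lattice of dominant index sets. -/
noncomputable abbrev dominantLattice (E : Finset α) (A : ι → Set α) :
    Lattice {K : Finset ι // IsDominant E A K} where
  sup K J := ⟨K.1 ∪ J.1, K.2.union J.2⟩
  le_sup_left _ _ := Finset.subset_union_left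
  le_sup_right _ _ := Finset.subset_union_right
  sup_le _ _ _ h1 h2 := Finset.union_subset h1 h2
  -- An intersection of dominant sets need not be dominant.
  inf K J := ⟨dominantKernel E A (K.1 ∩ J.1),
    IsDominant.biUnion _ fun _ h => (Finset.mem_filter.1 h).2⟩
  inf_le_left _ _ := Finset.biUnion_subset.2 fun _ h =>
    (Finset.mem_powerset.1 (Finset.mem_filter.1 h).1).trans Finset.inter_subset_left
  inf_le_right _ _ := Finset.biUnion_subset.2 fun _ h =>
    (Finset.mem_powerset.1 (Finset.mem_filter.1 h).1).trans Finset.inter_subset_right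
  le_inf H _ _ h1 h2 := Finset.subset_biUnion_of_mem id (Finset.mem_filter.2
    ⟨Finset.mem_powerset.2 (Finset.subset_inter h1 h2), H.2⟩)

/-- Two transversal matroids with the same dominant index sets, supporting equally many elements,
have the same configuration. -/
theorem haveSameConfiguration_of_isDominant_iff {α β : Type} {ι : Type} [Finite ι]
    {E : Finset α} {F : Finset β} {A : ι → Set α} {B : ι → Set β} (hEF : E.card = F.card)
    (hdom : ∀ K, IsDominant E A K ↔ IsDominant F B K)
    (hcard : ∀ K, IsDominant E A K → (supportedOn E A K).card = (supportedOn F B K).card) :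
    HaveSameConfiguration (transversalMatroid E A) (transversalMatroid F B) := by
  let e : {K : Finset ι // IsDominant E A K} ≃o {K : Finset ι // IsDominant F B K} :=
    { Equiv.subtypeEquivRight hdom with map_rel_iff' := Iff.rfl }
  refine ⟨{K : Finset ι // IsDominant E A K}, dominantLattice E A,
    fun K => (supportedOn E A K.1).card, fun K => K.1.card, E.card,
    ⟨Set.encard_coe_eq_coe_finsetCard E, dominantOrderIso E A, fun K => ⟨?_, ?_⟩⟩,
    ⟨?_, e.trans (dominantOrderIso F B), fun K => ⟨?_, ?_⟩⟩⟩
  · rw [coe_dominantOrderIso, Set.encard_coe_eq_coe_finsetCard]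
  · rw [coe_dominantOrderIso, K.2.eRk_supportedOn]
  · rw [hEF]
    exact Set.encard_coe_eq_coe_finsetCard F
  · exact (Set.encard_coe_eq_coe_finsetCard _).trans (congrArg _ (hcard _ K.2).symm)
  · exact ((hdom _).1 K.2).eRk_supportedOn

/-- A criterion for two presentations to have the same dominant index sets. -/
theorem haveSameConfiguration_of_card_supportedOn {α β : Type} {ι : Type} [Finite ι]
    {E : Finset α} {F : Finset β} {A : ι → Set α} {B : ι → Set β} (hEF : E.card = F.card)
    (hle : ∀ K, (supportedOn E A K).card ≤ (supportedOn F B K).card)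
    (hex : ∀ K, ∃ J ⊆ K, (supportedOn E A J).card = (supportedOn F B J).card ∧
      (supportedOn F B J).card + K.card = (supportedOn F B K).card + J.card) :
    HaveSameConfiguration (transversalMatroid E A) (transversalMatroid F B) := by
  -- A proper J from `hex` would have `A`-excess equal to the `B`-excess of K, which is at least the
  -- `A`-excess of K.
  have hA : ∀ K, IsDominant E A K → (supportedOn E A K).card = (supportedOn F B K).card := by
    intro K hK
    obtain ⟨J, hJK, h1, h2⟩ := hex K
    rcases hJK.eq_or_ssubset with rfl | h
    · exact h1
    · have := hK J h
      have := hle K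
      omega
  refine haveSameConfiguration_of_isDominant_iff hEF
    (fun K => ⟨fun hK J hJ => ?_, fun hK J hJ => ?_⟩) hA
  · obtain ⟨J', hJ', h1, h2⟩ := hex J
    have := hK J' (hJ'.trans_ssubset hJ)
    have := hA K hK
    omega
  -- `B`-dominance forces K' = K, since K' has the same `B`-excess; so both excesses agree at K.
  · obtain ⟨K', hK', h1, h2⟩ := hex K
    have := hK J hJ
    have := hle J
    rcases hK'.eq_or_ssubset with rfl | h
    · omega
    · have := hK K' h
      omega

end Transversal

/-! ### Unions of intervals with increasing endpoints -/

/-- The union of the intervals `[p i, q i)` for `i ∈ H`. -/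
def intervalCover {r : ℕ} (p q : Fin r → ℕ) (H : Finset (Fin r)) : Finset ℕ :=
  H.biUnion fun i => Finset.Ico (p i) (q i)

theorem mem_intervalCover {r : ℕ} {p q : Fin r → ℕ} {H : Finset (Fin r)} {x : ℕ} :
    x ∈ intervalCover p q H ↔ ∃ i ∈ H, p i ≤ x ∧ x < q i := by
  simp [intervalCover]

/-- With both endpoints increasing, only the last earlier interval k can hide part of interval j, so
the new points are those from max (q k) (p j) up to q j. -/
theorem card_intervalCover_insert {r : ℕ} {p q : Fin r → ℕ} (hp : Monotone p) (hq : Monotone q)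
    (hpq : ∀ i, p i ≤ q i) {H : Finset (Fin r)} {j k : Fin r} (hk : k ∈ H)
    (hmax : ∀ i ∈ H, i ≤ k) (hkj : k < j) :
    (intervalCover p q (insert j H)).card + max (q k) (p j) =
      (intervalCover p q H).card + q j := by
  have h1 : intervalCover p q (insert j H) =
      intervalCover p q H ∪ Finset.Ico (max (q k) (p j)) (q j) := by
    ext x
    simp only [Finset.mem_union, mem_intervalCover, Finset.mem_insert, Finset.mem_Ico, max_le_iff]
    constructor
    · rintro ⟨i, rfl | hi, h⟩
      · by_cases hx : q k ≤ x
        · exact Or.inr ⟨⟨hx, h.1⟩, h.2⟩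
        · exact Or.inl ⟨k, hk, (hp hkj.le).trans h.1, not_le.1 hx⟩
      · exact Or.inl ⟨i, hi, h⟩
    · rintro (⟨i, hi, h⟩ | h)
      · exact ⟨i, Or.inr hi, h⟩
      · exact ⟨j, Or.inl rfl, h.1.2, h.2⟩
  have h2 : Disjoint (intervalCover p q H) (Finset.Ico (max (q k) (p j)) (q j)) := by
    rw [Finset.disjoint_left]
    intro x hx hx'
    obtain ⟨i, hi, h⟩ := mem_intervalCover.1 hx
    have h3 := hq (hmax i hi)
    have h4 := (le_max_left _ _).trans (Finset.mem_Ico.1 hx').1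
    omega
  rw [h1, Finset.card_union_of_disjoint h2, Nat.card_Ico]
  have := hq hkj.le
  have := hpq j
  omega

/-- Shearing the intervals `[a i, b i)` to `[a i + i + 1, b i + i + 1]` enlarges their union by at
least the number of intervals, and by exactly this number if `H` contains all intervals between
two overlapping ones. -/
theorem card_add_card_intervalCover_le {r : ℕ} {a b : Fin r → ℕ} (ha : Monotone a)
    (hb : Monotone b) (hab : ∀ i, a i ≤ b i) (H : Finset (Fin r)) :
    H.card + (intervalCover a b H).card ≤
      (intervalCover (fun i => a i + i + 1) (fun i => b i + i + 2) H).card ∧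
    ((∀ h ∈ H, ∀ j ∈ H, ∀ i, h < i → i < j → a j < b h → i ∈ H) →
      (intervalCover (fun i => a i + i + 1) (fun i => b i + i + 2) H).card =
        H.card + (intervalCover a b H).card) := by
  induction H using Finset.induction_on_max with
  | empty => simp [intervalCover]
  | insert j H hj ih =>
    have hjH : j ∉ H := fun h => (hj j h).false
    rw [Finset.card_insert_of_notMem hjH]
    rcases H.eq_empty_or_nonempty with rfl | hne
    · have := hab j
      simp [intervalCover]
      omega
    have hk := H.max'_mem hne
    have hmax := fun i hi => H.le_max' i hi
    set k := H.max' hne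
    have hkj := hj k hk
    have e1 := card_intervalCover_insert ha hb hab hk hmax hkj
    have e2 := card_intervalCover_insert (p := fun i => a i + i + 1) (q := fun i => b i + i + 2)
      (fun x y hxy => by have := ha hxy; have : (x : ℕ) ≤ y := hxy; simp only; omega)
      (fun x y hxy => by have := hb hxy; have : (x : ℕ) ≤ y := hxy; simp only; omega)
      (fun i => by have := hab i; omega) hk hmax hkj
    have hkj' : (k : ℕ) < j := hkj
    refine ⟨by have := ih.1; omega, fun hgap => ?_⟩
    have ih2 := ih.2 fun h hh j' hj' i h1 h2 h3 => by
      refine Finset.mem_of_mem_insert_of_ne (hgap h (Finset.mem_insert_of_mem hh) j'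
        (Finset.mem_insert_of_mem hj') i h1 h2 h3) fun hij => ?_
      exact (hj j' hj').not_gt (hij ▸ h2)
    -- If j and k overlap, the no-gap condition makes them consecutive, so shearing adds exactly one
    -- new point; if they do not overlap, it adds exactly one in any case.
    by_cases hgap' : a j < b k
    · have hjk : (j : ℕ) = k + 1 := by
        by_contra hjk
        have hi : (k : ℕ) + 1 < r := by omega
        have h1 := hgap k (Finset.mem_insert_of_mem hk) j (Finset.mem_insert_self _ _)
          ⟨k + 1, hi⟩ (Fin.lt_def.2 (by simp)) (Fin.lt_def.2 (by simp; omega)) hgap'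
        have h2 : (⟨k + 1, hi⟩ : Fin r) ∈ H := Finset.mem_of_mem_insert_of_ne h1
          fun h => hjk (by rw [← h])
        have h3 : k + 1 ≤ (k : ℕ) := hmax _ h2
        omega
      omega
    · omega

/-! ### Positions of the north steps -/

namespace LatticePath

variable {m r : ℕ}

theorem height_eq_count (P : LatticePath m r) (k : ℕ) :
    P.height k = Nat.count (fun k => P.steps[k]? = some LatticeStep.north) k := by
  induction k with
  | zero => simp [height]
  | succ k ih =>
    rw [Nat.count_succ, ← ih, height, height, List.take_add_one, List.count_append]
    congr 1
    cases h : P.steps[k]? with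
    | none => simp
    | some s => cases s <;> simp

/-- The side condition of `Nat.count_nth`: it rules out the default value 0 of `Nat.nth`. -/
theorem lt_card_north (P : LatticePath m r) {i : ℕ} (hi : i < r)
    (hf : (Set.ofPred fun k : ℕ => P.steps[k]? = some LatticeStep.north).Finite) :
    i < hf.toFinset.card := by
  refine lt_of_lt_of_le ?_ (Nat.count_le_card hf P.steps.length)
  rw [← height_eq_count, height, List.take_length, P.count_north]
  exact hi

theorem height_stepsBeforeNorth (P : LatticePath m r) {i : ℕ} (hi : i < r) :
    P.height (P.stepsBeforeNorth i) = i := by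
  rw [height_eq_count]
  exact Nat.count_nth fun hf => P.lt_card_north hi hf

theorem height_stepsBeforeNorth_add_one (P : LatticePath m r) {i : ℕ} (hi : i < r) :
    P.height (P.stepsBeforeNorth i + 1) = i + 1 := by
  rw [height_eq_count]
  exact Nat.count_nth_succ fun hf => P.lt_card_north hi hf

theorem stepsBeforeNorth_lt_of_lt_height (P : LatticePath m r) {i k : ℕ} (h : i < P.height k) :
    P.stepsBeforeNorth i < k := by
  rw [height_eq_count] at h
  exact Nat.nth_lt_of_lt_count h

theorem stepsBeforeNorth_lt (P : LatticePath m r) {i j : ℕ} (hij : i < j) (hj : j < r) :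
    P.stepsBeforeNorth i < P.stepsBeforeNorth j :=
  P.stepsBeforeNorth_lt_of_lt_height (by rwa [P.height_stepsBeforeNorth hj])

theorem count_east_add_count_north (l : List LatticeStep) :
    l.count LatticeStep.east + l.count LatticeStep.north = l.length := by
  induction l with
  | nil => simp
  | cons s l ih => cases s <;> simp <;> omega

theorem northX_add (P : LatticePath m r) {i : ℕ} (hi : i < r) :
    P.northX i + i = P.stepsBeforeNorth i := by
  have h := count_east_add_count_north (P.steps.take (P.stepsBeforeNorth i))
  have h1 := P.height_stepsBeforeNorth hi
  have h2 : P.stepsBeforeNorth i < P.steps.length := by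
    refine P.stepsBeforeNorth_lt_of_lt_height ?_
    rw [height, List.take_length, P.count_north]
    exact hi
  rw [height] at h1
  rw [h1, List.length_take, min_eq_left h2.le] at h
  exact h

theorem northX_le (P : LatticePath m r) (i : ℕ) : P.northX i ≤ m :=
  ((List.take_sublist _ _).count_le _).trans P.count_east.le

theorem northX_mono (P : LatticePath m r) : Monotone fun i : Fin r => P.northX i := by
  have h : ∀ i j : Fin r, i < j → P.northX i ≤ P.northX j := fun i j hij =>
    ((List.take_sublist_take_left (P.stepsBeforeNorth_lt hij j.2).le).count_le _)
  intro i j hij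
  rcases hij.eq_or_lt with rfl | hij
  · exact le_rfl
  · exact h i j hij

/-- When P has just made its north step in row i, Q is at least as high, so Q has made its own. -/
theorem NeverAbove.northX_le {P Q : LatticePath m r} (hPQ : P.NeverAbove Q) {i : ℕ} (hi : i < r) :
    Q.northX i ≤ P.northX i := by
  have h1 := hPQ (P.stepsBeforeNorth i + 1)
  rw [P.height_stepsBeforeNorth_add_one hi] at h1
  have h2 := Q.stepsBeforeNorth_lt_of_lt_height h1
  have h3 := P.northX_add hi
  have h4 := Q.northX_add hi
  omega

end LatticePath

/-! ### Comparison of the path and rook presentations -/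

section Presentations

variable {m r : ℕ} (P Q : LatticePath m r)

theorem mem_pathPresentation {i : Fin r} {x : ℕ} : x ∈ pathPresentation P Q i ↔
    Q.northX i + i + 1 ≤ x ∧ x < P.northX i + i + 2 := by
  have h1 := P.northX_add i.2
  have h2 := Q.northX_add i.2
  rw [pathPresentation, Set.mem_Icc, LatticePath.northPos, LatticePath.northPos]
  omega

theorem card_supportedOn_pathPresentation (K : Finset (Fin r)) :
    (supportedOn (Finset.Icc 1 (m + r)) (pathPresentation P Q) K).card +
      (intervalCover (fun i : Fin r => Q.northX i + i + 1) (fun i : Fin r => P.northX i + i + 2)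
        Kᶜ).card = m + r := by
  have h : intervalCover (fun i : Fin r => Q.northX i + i + 1)
      (fun i : Fin r => P.northX i + i + 2) Kᶜ =
      Finset.Icc 1 (m + r) \ supportedOn (Finset.Icc 1 (m + r)) (pathPresentation P Q) K := by
    ext x
    simp only [mem_intervalCover, Finset.mem_sdiff, mem_supportedOn, mem_pathPresentation,
      Finset.mem_compl, Finset.mem_Icc, not_and, not_forall]
    constructor
    · rintro ⟨i, hi, h1, h2⟩
      have := P.northX_le i
      exact ⟨by omega, fun _ => ⟨i, ⟨h1, h2⟩, hi⟩⟩
    · rintro ⟨hx, h⟩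
      obtain ⟨i, h1, hi⟩ := h hx
      exact ⟨i, hi, h1⟩
  rw [h, add_comm, Finset.card_sdiff_add_card_eq_card (supportedOn_subset _ _ _), Nat.card_Icc]
  omega

/-- The unsupported elements are the labels of the rows outside K and of the columns these rows
meet; the two kinds of labels are disjoint. -/
theorem card_supportedOn_rookPresentation (K : Finset (Fin r)) :
    (supportedOn (Finset.Icc 1 (m + r)) (rookPresentation P Q) K).card + (Kᶜ.card +
      (intervalCover (fun i : Fin r => Q.northX i) (fun i : Fin r => P.northX i) Kᶜ).card) =
      m + r := by
  obtain ⟨f, hf⟩ : ∃ f : Fin r ↪ ℕ, ∀ i, f i = i + 1 :=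
    ⟨⟨fun i => i + 1, fun i j h => Fin.ext (Nat.add_right_cancel h)⟩, fun _ => rfl⟩
  obtain ⟨g, hg⟩ : ∃ g : ℕ ↪ ℕ, ∀ c, g c = r + (c + 1) :=
    ⟨⟨fun c => r + (c + 1), fun i j h => Nat.add_right_cancel (Nat.add_left_cancel h)⟩,
      fun _ => rfl⟩
  set C := intervalCover (fun i : Fin r => Q.northX i) (fun i : Fin r => P.northX i) Kᶜ with hC
  have h : Kᶜ.map f ∪ C.map g =
      Finset.Icc 1 (m + r) \ supportedOn (Finset.Icc 1 (m + r)) (rookPresentation P Q) K := by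
    ext x
    simp only [hC, Finset.mem_union, Finset.mem_map, mem_intervalCover, Finset.mem_sdiff,
      mem_supportedOn, Finset.mem_compl, Finset.mem_Icc, not_and, not_forall, rookPresentation,
      SquareInDiagram, Set.mem_union, Set.mem_singleton_iff, Set.mem_ofPred_eq, hf, hg]
    constructor
    · rintro (⟨i, hi, rfl⟩ | ⟨c, ⟨i, hi, h1, h2⟩, rfl⟩)
      · have := i.2
        exact ⟨by omega, fun _ => ⟨i, Or.inl rfl, hi⟩⟩
      · have := P.northX_le i
        exact ⟨by omega, fun _ => ⟨i, Or.inr ⟨c, by omega, ⟨h1, h2⟩, rfl⟩, hi⟩⟩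
    · rintro ⟨hx, h⟩
      obtain ⟨i, h1 | ⟨c, -, h1, rfl⟩, hi⟩ := h hx
      · exact Or.inl ⟨i, hi, h1.symm⟩
      · exact Or.inr ⟨c, ⟨i, hi, h1⟩, rfl⟩
  have hd : Disjoint (Kᶜ.map f) (C.map g) := by
    rw [Finset.disjoint_left]
    intro x hx hx'
    obtain ⟨i, -, rfl⟩ := Finset.mem_map.1 hx
    obtain ⟨c, -, hc⟩ := Finset.mem_map.1 hx'
    rw [hf, hg] at hc
    omega
  rw [← Finset.card_map f, ← Finset.card_map (s := C) g, ← Finset.card_union_of_disjoint hd, h,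
    add_comm, Finset.card_sdiff_add_card_eq_card (supportedOn_subset _ _ _), Nat.card_Icc]
  omega

end Presentations

theorem mainTheorem5 {m r : ℕ} (P Q : LatticePath m r) (hPQ : P.NeverAbove Q) :
    HaveSameConfiguration (latticePathMatroid P Q) (rookMatroid P Q) := by
  classical
  have hab : ∀ i : Fin r, Q.northX i ≤ P.northX i := fun i => hPQ.northX_le i.2
  have key := card_add_card_intervalCover_le Q.northX_mono P.northX_mono hab
  refine haveSameConfiguration_of_card_supportedOn rfl (fun K => ?_) (fun K => ?_)
  · have h1 := card_supportedOn_pathPresentation P Q K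
    have h2 := card_supportedOn_rookPresentation P Q K
    have h3 := (key Kᶜ).1
    omega
  · -- keep the rows of `K` with a square in a column all of whose squares are in rows of `K`
    let C := intervalCover (fun i : Fin r => Q.northX i) (fun i : Fin r => P.northX i) Kᶜ
    let H : Finset (Fin r) := {i | Finset.Ico (Q.northX i) (P.northX i) ⊆ C}
    have hKH : Kᶜ ⊆ H := fun i hi => Finset.mem_filter.2 ⟨Finset.mem_univ _, fun x hx =>
      mem_intervalCover.2 ⟨i, hi, Finset.mem_Ico.1 hx⟩⟩
    have hC : intervalCover (fun i : Fin r => Q.northX i) (fun i : Fin r => P.northX i) H = C := by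
      ext x
      constructor
      · intro hx
        obtain ⟨i, hi, h⟩ := mem_intervalCover.1 hx
        exact (Finset.mem_filter.1 hi).2 (Finset.mem_Ico.2 h)
      · intro hx
        obtain ⟨i, hi, h⟩ := mem_intervalCover.1 hx
        exact mem_intervalCover.2 ⟨i, hKH hi, h⟩
    -- A row between two overlapping rows lies within the union of their column intervals.
    have hgap : ∀ h ∈ H, ∀ j ∈ H, ∀ i, h < i → i < j → Q.northX j < P.northX h → i ∈ H := by
      intro h hh j hj i hhi hij hov
      refine Finset.mem_filter.2 ⟨Finset.mem_univ _, fun x hx => ?_⟩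
      have hx := Finset.mem_Ico.1 hx
      have h1 : Q.northX h ≤ Q.northX i := Q.northX_mono hhi.le
      have h2 : P.northX i ≤ P.northX j := P.northX_mono hij.le
      by_cases hxh : x < P.northX h
      · exact (Finset.mem_filter.1 hh).2 (Finset.mem_Ico.2 ⟨by omega, hxh⟩)
      · exact (Finset.mem_filter.1 hj).2 (Finset.mem_Ico.2 ⟨by omega, by omega⟩)
    refine ⟨Hᶜ, compl_le_iff_compl_le.1 hKH, ?_, ?_⟩
    · have h1 := card_supportedOn_pathPresentation P Q Hᶜ
      have h2 := card_supportedOn_rookPresentation P Q Hᶜ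
      have h3 := (key H).2 hgap
      rw [compl_compl] at h1 h2
      omega
    -- Both rook excesses equal m + r - r - |C|, as K and Hᶜ have the same C.
    · have h1 := card_supportedOn_rookPresentation P Q K
      have h2 := card_supportedOn_rookPresentation P Q Hᶜ
      rw [compl_compl, hC] at h2
      change _ + (_ + C.card) = _ at h1
      have h3 := Finset.card_add_card_compl K
      have h4 := Finset.card_add_card_compl H
      omega
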